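/- Let $f_\alpha:[0,\infty)\to[0,\infty)$ $(\alpha\ge 0)$ be a family of functions such that each $f_\alpha$ is operator monotone on $[0,\infty)$, that is, $0\le a\le b$ implies $f_\alpha(a)\le f_\alpha(b)$ for all bounded operators $a,b$ on any complex Hilbert space ($f(a)$ denotes the Borel functional calculus, which is the continuous functional calculus when $f$ is continuous on the spectrum of $a$). Suppose that the family increases in $\alpha$, that is, $f_\alpha(t)\le f_\beta(t)$ for $0\le\alpha\le\beta$ and $t\ge 0$, and that the limit $f_\infty(t)=\lim_{\alpha\to\infty}f_\alpha(t)$ exists and is finite for every $t\ge 0$. Let $H$ be a separable complex Hilbert space. For a positive operator $a\in B(H)^+$ let $\operatorname{rank}(a)\in\{0,1,2,\dots,\infty\}$ be the dimension of the closure of $aH$, and put $\varphi(a)=f_{\operatorname{rank}(a)}(a)$. Then $\varphi$ maps $B(H)^+$ into $B(H)^+$, and: (1) for $a,b\in B(H)^+$, $a\le b$ implies $\varphi(a)\le\varphi(b)$; (2) for every invertible contraction $c\in B(H)$ (invertible with $\|c\|\le 1$) and every $a\in B(H)^+$, $c^*\varphi(a)c\le\varphi(c^*ac)$; (3) if $H$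 is infinite-dimensional and $f_m\ne f_n$ on $[0,\infty)$ for some integers $m,n\ge 1$, then $\varphi$ is not a continuous functional calculus: there is no continuous $g:[0,\infty)\to\mathbb{R}$ with $\varphi(a)=g(a)$ for all $a\in B(H)^+$. -/

import Mathlib

open MeasureTheory Filter Topology
open scoped CompactlySupported InnerProductSpace

universe u

set_option linter.unusedSimpArgs false

noncomputable section BorelCalculus

variable {H : Type*} [NormedAddCommGroup H] [InnerProductSpace ℂ H] [CompleteSpace H]

/-- The positive functional `g ↦ ⟨x, g(a) x⟩` on `C_c(ℝ)`, for self-adjoint `a`. -/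
def spectralFunctional (a : H →L[ℂ] H) (x : H) : C_c(ℝ, ℝ) →ₚ[ℝ] ℝ :=
  PositiveLinearMap.mk₀
    { toFun := fun g => (inner ℂ x (cfc (fun t : ℝ => g t) a x)).re
      map_add' := fun g h => by
        have := cfc_add a (fun t : ℝ => g t) (fun t : ℝ => h t)
          g.continuous.continuousOn h.continuous.continuousOn
        simp [this]
      map_smul' := fun r g => by
        have := cfc_smul r (fun t : ℝ => g t) a g.continuous.continuousOn
        simp only [CompactlySupportedContinuousMap.smul_apply, this]
        simp [inner_smul_right_eq_smul] }
    (fun g hg => by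
      have h : 0 ≤ cfc (fun t : ℝ => g t) a := cfc_nonneg (fun t _ => hg t)
      rw [ContinuousLinearMap.nonneg_iff_isPositive] at h
      exact h.re_inner_nonneg_right x)

/-- The spectral measure `μ_x` of the self-adjoint operator `a` at the vector `x`: the
Riesz–Markov–Kakutani measure with `∫ g dμ_x = ⟨x, g(a) x⟩` for continuous `g`, where `g(a)` is the
continuous functional calculus. It is carried by the spectrum of `a`. -/
def spectralMeasure (a : H →L[ℂ] H) (x : H) : Measure ℝ :=
  RealRMK.rieszMeasure (spectralFunctional a x)

theorem integral_spectralMeasure (a : H →L[ℂ] H) (x : H) (g : C_c(ℝ, ℝ)) :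
    ∫ t, g t ∂(spectralMeasure a x) = (inner ℂ x (cfc (fun t : ℝ => g t) a x)).re :=
  RealRMK.integral_rieszMeasure _ g

theorem spectralMeasure_compact_le (a : H →L[ℂ] H) (x : H) {K : Set ℝ} (hK : IsCompact K) :
    spectralMeasure a x K ≤ ENNReal.ofReal (‖x‖ ^ 2) := by
  obtain ⟨f, hf1, -, hfc, hf⟩ := exists_continuous_one_zero_of_isCompact hK isClosed_empty
    (Set.disjoint_empty K)
  refine (RealRMK.rieszMeasure_le_of_eq_one (spectralFunctional a x) (f := ⟨f, hfc⟩)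
    (fun t => (hf t).1) hK (fun t ht => hf1 ht)).trans (ENNReal.ofReal_le_ofReal ?_)
  change (inner ℂ x (cfc (fun t : ℝ => f t) a x)).re ≤ _
  have h1 : ‖cfc (fun t : ℝ => f t) a‖ ≤ 1 :=
    norm_cfc_le zero_le_one fun t _ => by
      rw [Real.norm_of_nonneg (hf t).1]; exact (hf t).2
  calc _ ≤ ‖inner ℂ x (cfc (fun t : ℝ => f t) a x)‖ := Complex.re_le_norm _
    _ ≤ ‖x‖ * ‖cfc (fun t : ℝ => f t) a x‖ := norm_inner_le_norm _ _
    _ ≤ ‖x‖ * (1 * ‖x‖) := by gcongr; exact ContinuousLinearMap.le_of_opNorm_le _ h1 x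
    _ = _ := by ring

theorem spectralMeasure_univ_le (a : H →L[ℂ] H) (x : H) :
    spectralMeasure a x Set.univ ≤ ENNReal.ofReal (‖x‖ ^ 2) := by
  have : (spectralMeasure a x).Regular := RealRMK.regular_rieszMeasure _
  rw [isOpen_univ.measure_eq_iSup_isCompact]
  exact iSup_le fun K => iSup_le fun _ => iSup_le fun hK => spectralMeasure_compact_le a x hK

instance (a : H →L[ℂ] H) (x : H) : IsFiniteMeasure (spectralMeasure a x) :=
  ⟨(spectralMeasure_univ_le a x).trans_lt ENNReal.ofReal_lt_top⟩

theorem spectralMeasure_compl_spectrum (a : H →L[ℂ] H) (x : H) :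
    spectralMeasure a x (spectrum ℝ a)ᶜ = 0 := by
  have : (spectralMeasure a x).Regular := RealRMK.regular_rieszMeasure _
  rw [(spectrum.isClosed a).isOpen_compl.measure_eq_iSup_isCompact]
  simp only [ENNReal.iSup_eq_zero]
  intro K hKs hK
  obtain ⟨f, hf1, hf0, hfc, hf⟩ := exists_continuous_one_zero_of_isCompact hK
    (spectrum.isClosed (𝕜 := ℝ) a) (Set.disjoint_left.2 fun t ht => hKs ht)
  refine le_antisymm ((RealRMK.rieszMeasure_le_of_eq_one (spectralFunctional a x) (f := ⟨f, hfc⟩)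
    (fun t => (hf t).1) hK (fun t ht => hf1 ht)).trans ?_) zero_le
  change ENNReal.ofReal (inner ℂ x (cfc (fun t : ℝ => f t) a x)).re ≤ _
  have h0 : cfc (fun t : ℝ => f t) a = 0 := by
    rw [cfc_congr (g := fun _ : ℝ => (0 : ℝ)) (fun t ht => hf0 ht)]
    simp
  simp [h0]

theorem ae_mem_spectrum (a : H →L[ℂ] H) (x : H) : ∀ᵐ t ∂(spectralMeasure a x), t ∈ spectrum ℝ a :=
  spectralMeasure_compl_spectrum a x

theorem integrable_spectralMeasure {a : H →L[ℂ] H} {f : ℝ → ℝ} {C : ℝ}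
    (hf : Measurable ((spectrum ℝ a).domRestrict f)) (hC : ∀ t ∈ spectrum ℝ a, |f t| ≤ C) (x : H) :
    Integrable f (spectralMeasure a x) := by
  have hs : MeasurableSet (spectrum ℝ a) := (spectrum.isClosed a).measurableSet
  refine Integrable.of_bound (C := C) ?_ ?_
  · have h2 : (spectralMeasure a x).restrict (spectrum ℝ a) = spectralMeasure a x :=
      Measure.restrict_eq_self_of_ae_mem (ae_mem_spectrum a x)
    rw [← h2]
    exact (aemeasurable_restrict_of_measurable_subtype hs hf).aestronglyMeasurable
  · filter_upwards [ae_mem_spectrum a x] with t ht using hC t ht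

theorem sum_integral_spectralMeasure_eq_zero {a : H →L[ℂ] H} {f : ℝ → ℝ}
    (hf : ∀ x, Integrable f (spectralMeasure a x)) {n : ℕ} (c : Fin n → ℝ) (v : Fin n → H)
    (h : ∀ T : H →L[ℂ] H, IsSelfAdjoint T → ∑ i, c i * (inner ℂ (v i) (T (v i))).re = 0) :
    ∑ i, c i * ∫ t, f t ∂(spectralMeasure a (v i)) = 0 := by
  let P : Measure ℝ := ∑ i, (c i).toNNReal • spectralMeasure a (v i)
  let N : Measure ℝ := ∑ i, (-c i).toNNReal • spectralMeasure a (v i)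
  have key : ∀ g : ℝ → ℝ, (∀ x, Integrable g (spectralMeasure a x)) →
      ∫ t, g t ∂P - ∫ t, g t ∂N = ∑ i, c i * ∫ t, g t ∂(spectralMeasure a (v i)) := by
    intro g hg
    rw [integral_finsetSum_measure (fun i _ => (hg _).smul_measure_nnreal),
      integral_finsetSum_measure (fun i _ => (hg _).smul_measure_nnreal), ← Finset.sum_sub_distrib]
    refine Finset.sum_congr rfl fun i _ => ?_
    rw [integral_smul_nnreal_measure, integral_smul_nnreal_measure, NNReal.smul_def,
      NNReal.smul_def, Real.coe_toNNReal', Real.coe_toNNReal', smul_eq_mul, smul_eq_mul, ← sub_mul]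
    congr 1
    rcases le_total 0 (c i) with h | h
    · rw [max_eq_left h, max_eq_right (by linarith)]; ring
    · rw [max_eq_right h, max_eq_left (by linarith)]; ring
  have hPN : P = N := by
    refine Measure.ext_of_integral_eq_on_compactlySupported fun g => ?_
    rw [← sub_eq_zero, key g (fun x => g.continuous.integrable_of_hasCompactSupport g.hasCompactSupport)]
    simp only [integral_spectralMeasure]
    exact h _ (cfc_predicate _ _)
  rw [← key f hf, hPN, sub_self]

/-- For every Borel function `f` that is bounded on the spectrum of `a`, the quadratic form
`x ↦ ∫ f dμ_x` is the quadratic form of a bounded operator. -/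
theorem exists_quadratic_rep {a : H →L[ℂ] H} {f : ℝ → ℝ} {C : ℝ}
    (hf : Measurable ((spectrum ℝ a).domRestrict f)) (hC : ∀ t ∈ spectrum ℝ a, |f t| ≤ C) :
    ∃ T : H →L[ℂ] H, ∀ x, inner ℂ x (T x) = ((∫ t, f t ∂(spectralMeasure a x) : ℝ) : ℂ) := by
  have hint := integrable_spectralMeasure hf hC
  obtain ⟨q, hq⟩ : ∃ q : H → ℝ, ∀ x, q x = ∫ t, f t ∂(spectralMeasure a x) := ⟨_, fun _ => rfl⟩
  have hC' : ∀ t ∈ spectrum ℝ a, |f t| ≤ |C| := fun t ht => (hC t ht).trans (le_abs_self C)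
  have hb : ∀ x, |q x| ≤ |C| * ‖x‖ ^ 2 := fun x => by
    rw [hq]
    refine (norm_integral_le_of_norm_le_const (μ := spectralMeasure a x) (f := f) (C := |C|) ?_).trans ?_
    · filter_upwards [ae_mem_spectrum a x] with t ht using hC' t ht
    · gcongr
      exact ENNReal.toReal_le_of_le_ofReal (by positivity) (spectralMeasure_univ_le a x)
  have tr : ∀ {n : ℕ} (c : Fin n → ℝ) (v : Fin n → H), (∀ T : H →L[ℂ] H, IsSelfAdjoint T →
      ∑ i, c i * (inner ℂ (v i) (T (v i))).re = 0) → ∑ i, c i * q (v i) = 0 := by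
    intro n c v h
    simp only [hq]
    exact sum_integral_spectralMeasure_eq_zero hint c v h
  obtain ⟨R, hR⟩ : ∃ R : H → H → ℝ, ∀ x y, R x y = (q (x + y) - q (x - y)) / 4 :=
    ⟨_, fun _ _ => rfl⟩
  have Radd : ∀ x y z, R x (y + z) = R x y + R x z := fun x y z => by
    have := tr ![1, -1, -1, 1, -1, 1]
      ![x + (y + z), x - (y + z), x + y, x - y, x + z, x - z] (fun T _ => by
        simp [Fin.sum_univ_succ, inner_add_left, inner_sub_left, inner_add_right, inner_sub_right]
        ring)
    simp [Fin.sum_univ_succ] at this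
    rw [hR, hR, hR]; linarith
  have Rsmul : ∀ x y (r : ℝ), R x ((r : ℂ) • y) = r * R x y := fun x y r => by
    have := tr ![1, -1, -r, r] ![x + (r : ℂ) • y, x - (r : ℂ) • y, x + y, x - y] (fun T _ => by
        simp [Fin.sum_univ_succ, inner_add_left, inner_sub_left, inner_add_right, inner_sub_right,
          inner_smul_left, inner_smul_right]
        ring)
    simp [Fin.sum_univ_succ] at this
    rw [hR, hR]; simp only [Complex.coe_smul]; linarith
  have Rsymm : ∀ x y, R x y = R y x := fun x y => by
    have := tr ![1, -1] ![x - y, y - x] (fun T _ => by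
        simp [Fin.sum_univ_succ, inner_sub_left, inner_sub_right]
        ring)
    simp [Fin.sum_univ_succ] at this
    rw [hR, hR, add_comm y x]; linarith
  have RI : ∀ x y, R (Complex.I • x) (Complex.I • y) = R x y := fun x y => by
    have hI : ∀ v, q (Complex.I • v) = q v := fun v => by
      have := tr ![1, -1] ![Complex.I • v, v] (fun T _ => by
        simp [Fin.sum_univ_succ, inner_smul_left, inner_smul_right])
      simp [Fin.sum_univ_succ] at this
      linarith
    rw [hR, hR, ← smul_add, ← smul_sub, hI, hI]
  have Rneg : ∀ x y, R x (-y) = - R x y := fun x y => by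
    simpa using Rsmul x y (-1)
  obtain ⟨B, hB⟩ : ∃ B : H → H → ℂ, ∀ x y, B x y = R x y - R x (Complex.I • y) * Complex.I :=
    ⟨_, fun _ _ => rfl⟩
  have Badd : ∀ x y z, B x (y + z) = B x y + B x z := fun x y z => by
    simp only [hB, smul_add, Radd]; push_cast; ring
  have Bsmul : ∀ (z : ℂ) x y, B x (z • y) = z * B x y := fun z x y => by
    have e1 : z • y = (z.re : ℂ) • y + (z.im : ℂ) • (Complex.I • y) := by
      rw [smul_smul, ← add_smul, Complex.re_add_im]
    have e2 : Complex.I • z • y = (z.re : ℂ) • (Complex.I • y) + (z.im : ℂ) • (-y) := by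
      rw [e1, smul_add, smul_comm, smul_comm Complex.I (z.im : ℂ), smul_smul Complex.I Complex.I,
        Complex.I_mul_I, neg_one_smul]
    rw [hB, hB, e2, e1, Radd, Radd, Rsmul, Rsmul, Rsmul, Rsmul, Rneg]
    conv_rhs => rw [← Complex.re_add_im z]
    push_cast
    linear_combination (z.im * (R x (Complex.I • y) : ℂ)) * Complex.I_mul_I
  have Bsymm : ∀ x y, B y x = (starRingEnd ℂ) (B x y) := fun x y => by
    have : R y (Complex.I • x) = - R x (Complex.I • y) := by
      rw [← RI, smul_smul, Complex.I_mul_I, neg_one_smul, Rneg, Rsymm]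
    rw [hB, hB, this, Rsymm y x]
    simp
  have Bb : ∀ x y, ‖B x y‖ ≤ |C| * (‖x‖ ^ 2 + ‖y‖ ^ 2) := fun x y => by
    have hRb : ∀ x y, |R x y| ≤ |C| / 2 * (‖x‖ ^ 2 + ‖y‖ ^ 2) := fun x y => by
      have h1 := abs_le.1 (hb (x + y))
      have h2 := abs_le.1 (hb (x - y))
      have h3 := parallelogram_law_with_norm ℂ x y
      have h4 : |C| * ‖x + y‖ ^ 2 + |C| * ‖x - y‖ ^ 2 = |C| * (2 * (‖x‖ ^ 2 + ‖y‖ ^ 2)) := by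
        rw [← mul_add]; congr 1
      rw [hR, abs_le]; constructor <;> linarith
    rw [hB]
    refine (norm_sub_le _ _).trans ?_
    rw [norm_mul, Complex.norm_I, mul_one, Complex.norm_real, Complex.norm_real]
    have h1 := hRb x y
    have h2 := hRb x (Complex.I • y)
    rw [norm_smul, Complex.norm_I, one_mul] at h2
    simp only [Real.norm_eq_abs]
    linarith
  let L : H →ₗ⋆[ℂ] H →ₗ[ℂ] ℂ := LinearMap.mk₂'ₛₗ (starRingEnd ℂ) (RingHom.id ℂ) B
    (fun x x' y => by rw [Bsymm y, Badd, map_add, ← Bsymm, ← Bsymm])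
    (fun z x y => by rw [Bsymm y, Bsmul, map_mul, ← Bsymm, smul_eq_mul])
    Badd (fun z x y => Bsmul z x y)
  let T := InnerProductSpace.continuousLinearMapOfBilin
    (L.mkContinuous₂ (|C| * 2) (fun x y => by
      change ‖B x y‖ ≤ _
      rcases eq_or_ne x 0 with rfl | hx
      · have : B 0 y = 0 := by rw [Bsymm y, ← zero_smul ℂ (0 : H), Bsmul]; simp
        simp [this]
      rcases eq_or_ne y 0 with rfl | hy
      · have : B x 0 = 0 := by rw [← zero_smul ℂ (0 : H), Bsmul]; simp
        simp [this]
      have hx' := norm_pos_iff.2 hx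
      have hy' := norm_pos_iff.2 hy
      have h := Bb (((‖x‖⁻¹ : ℝ) : ℂ) • x) (((‖y‖⁻¹ : ℝ) : ℂ) • y)
      rw [Bsmul, Bsymm y, Bsmul, map_mul, ← Bsymm] at h
      simp only [norm_mul, norm_smul, RCLike.norm_conj, Complex.norm_real, norm_inv, norm_norm] at h
      rw [inv_mul_cancel₀ hx'.ne', inv_mul_cancel₀ hy'.ne'] at h
      have h5 : ‖B x y‖ = ‖x‖ * ‖y‖ * (‖y‖⁻¹ * (‖x‖⁻¹ * ‖B x y‖)) := by field_simp
      rw [h5]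
      calc _ ≤ ‖x‖ * ‖y‖ * (|C| * (1 ^ 2 + 1 ^ 2)) := by gcongr
        _ = _ := by ring))
  refine ⟨T, fun x => ?_⟩
  have h1 : inner ℂ (T x) x = B x x := InnerProductSpace.continuousLinearMapOfBilin_apply _ x x
  have h2 : B x x = (q x : ℂ) := by
    have e1 : R x x = q x := by
      have := tr ![1, -1, -4] ![x + x, x - x, x] (fun T _ => by
        simp [Fin.sum_univ_succ, inner_add_left, inner_add_right]
        ring)
      simp [Fin.sum_univ_succ] at this
      rw [hR]; simp; linarith
    have e2 : R x (Complex.I • x) = 0 := by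
      have := RI x (Complex.I • x)
      rw [smul_smul, Complex.I_mul_I, neg_one_smul, Rneg, Rsymm] at this
      linarith
    rw [hB, e1, e2]; simp
  rw [← inner_conj_symm, h1, h2, Complex.conj_ofReal, hq]

open Classical in
/-- The Borel functional calculus `f(a)` of a self-adjoint operator `a`: the unique bounded operator
with `⟨x, f(a) x⟩ = ∫ f dμ_x` for all `x`. It exists whenever `f` is Borel and bounded on the
spectrum of `a` (`inner_borelCalculus`); it is set to `0` if there is no such operator. -/
def borelCalculus (f : ℝ → ℝ) (a : H →L[ℂ] H) : H →L[ℂ] H :=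
  if h : ∃ T : H →L[ℂ] H, ∀ x, inner ℂ x (T x) = ((∫ t, f t ∂(spectralMeasure a x) : ℝ) : ℂ)
  then h.choose else 0

theorem inner_borelCalculus {a : H →L[ℂ] H} {f : ℝ → ℝ} {C : ℝ}
    (hf : Measurable ((spectrum ℝ a).domRestrict f)) (hC : ∀ t ∈ spectrum ℝ a, |f t| ≤ C) (x : H) :
    inner ℂ x (borelCalculus f a x) = ((∫ t, f t ∂(spectralMeasure a x) : ℝ) : ℂ) := by
  have h := exists_quadratic_rep hf hC
  rw [borelCalculus, dif_pos h]
  exact h.choose_spec x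

/-- Uniqueness of the operator in the definition of `f(a)`. -/
theorem eq_borelCalculus {a T : H →L[ℂ] H} {f : ℝ → ℝ}
    (hT : ∀ x, inner ℂ x (T x) = ((∫ t, f t ∂(spectralMeasure a x) : ℝ) : ℂ)) :
    borelCalculus f a = T := by
  have h : ∃ T : H →L[ℂ] H, ∀ x, inner ℂ x (T x) =
    ((∫ t, f t ∂(spectralMeasure a x) : ℝ) : ℂ) := ⟨T, hT⟩
  rw [borelCalculus, dif_pos h]
  refine ContinuousLinearMap.coe_injective ((ext_inner_map _ _).1 fun x => ?_)
  have h1 := h.choose_spec x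
  rw [← hT x] at h1
  have h2 := congrArg (starRingEnd ℂ) h1
  rwa [inner_conj_symm, inner_conj_symm] at h2

/-- For `f` continuous on the spectrum, the Borel calculus is the continuous one. -/
theorem borelCalculus_eq_cfc {a : H →L[ℂ] H} {f : ℝ → ℝ}
    (hf : ContinuousOn f (spectrum ℝ a)) : borelCalculus f a = cfc f a := by
  have hs : IsClosed (spectrum ℝ a) := spectrum.isClosed a
  obtain ⟨g, hg⟩ := ContinuousMap.exists_restrict_eq hs ⟨_, hf.domRestrict⟩
  obtain ⟨u, hu1, -, huc, -⟩ := exists_continuous_one_zero_of_isCompact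
    (ContinuousFunctionalCalculus.isCompact_spectrum (R := ℝ) a) isClosed_empty
    (Set.disjoint_empty _)
  let k : C_c(ℝ, ℝ) := ⟨u * g, huc.mul_right⟩
  have hk : Set.EqOn f k (spectrum ℝ a) := fun t ht => by
    have h1 : g t = f t := congrArg (fun F => F ⟨t, ht⟩) hg
    have h2 : u t = 1 := hu1 ht
    change f t = u t * g t
    rw [h1, h2, one_mul]
  refine eq_borelCalculus fun x => ?_
  have h1 : ∫ t, f t ∂(spectralMeasure a x) = ∫ t, k t ∂(spectralMeasure a x) :=
    integral_congr_ae (by filter_upwards [ae_mem_spectrum a x] with t ht using hk ht)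
  rw [h1, integral_spectralMeasure, ← cfc_congr hk]
  have h2 : IsSelfAdjoint (cfc f a) := cfc_predicate f a
  exact (h2.isSymmetric.coe_re_inner_self_apply x).symm

/-- The rank of `a`, that is, the dimension of the closure of `a H`, with all infinite dimensions
identified with `∞ = ⊤`. -/
def operatorRank (a : H →L[ℂ] H) : ℕ∞ :=
  Cardinal.toENat (Module.rank ℂ (LinearMap.range (a : H →ₗ[ℂ] H)).topologicalClosure)

/-- `φ(a) = f_{rank(a)}(a)`, where `f_∞` is used for operators of infinite rank. -/
def rankCalculus (f : ℝ → ℝ → ℝ) (fInf : ℝ → ℝ) (a : H →L[ℂ] H) : H →L[ℂ] H :=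
  borelCalculus (ENat.recTopCoe fInf (fun n : ℕ => f n) (operatorRank a) : ℝ → ℝ) a

end BorelCalculus

/-- `f` is operator monotone on `[0, ∞)`: `0 ≤ a ≤ b` implies `f(a) ≤ f(b)` for bounded operators on
any Hilbert space. On a one-dimensional space this says that `f` is increasing on `[0, ∞)`, so that
`f` is Borel and bounded on the spectrum of each positive operator. -/
def OperatorMonotone (f : ℝ → ℝ) : Prop :=
  ∀ (K : Type u) [NormedAddCommGroup K] [InnerProductSpace ℂ K] [CompleteSpace K]
    (a b : K →L[ℂ] K), 0 ≤ a → a ≤ b → borelCalculus f a ≤ borelCalculus f b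

/-!
Everything is read off from the spectral measures `μ_{a,x}`: an inequality `f(a) ≤ g(b)` between
Borel functions of positive operators means `∫ f dμ_{a,x} ≤ ∫ g dμ_{b,x}` for all vectors `x`
(`borelCalculus_le_iff`), and an isometry `V` with `V p = a V` satisfies `μ_{a,Vx} = μ_{p,x}`
(`spectralMeasure_of_intertwine`), because it intertwines polynomials in `p` and `a`, hence also
continuous functions of them.

Write `f_r` for `r ∈ {0, 1, …, ∞}`. All `f_r` are nonnegative and operator monotone, the case
`r = ∞` being dominated convergence (`OperatorMonotone.of_tendsto`), and they increase with `r`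
(`recTopCoe_le`). The rank grows with the operator, since `0 ≤ a ≤ b` forces `ker b ⊆ ker a`
(`operatorRank_mono`), so `f_{rank a}(a) ≤ f_{rank a}(b) ≤ f_{rank b}(b)`. In the same way the
second assertion follows from Hansen's inequality `c⋆ f(a) c ≤ f(c⋆ a c)` for a single function and
`rank a ≤ rank (c⋆ a c)` for invertible `c` (`operatorRank_le_conj`).

Hansen's inequality (`OperatorMonotone.conj_borelCalculus_le`) has to be proved for functions that
may jump at `0`. Let `U` be the unitary dilation of the contraction `c` on `H ⊕ H`, with first row
`(c, d)`. Then `U⋆ (a ⊕ 0) U` has corner `c⋆ a c` and is dominated by the block-diagonal operator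
`(1 + δ) c⋆ a c ⊕ (1 + δ⁻¹) d⋆ a d`. Applying `f` and compressing to the corner gives
`c⋆ f(a) c ≤ f((1 + δ) c⋆ a c)`, since `f(0) ≥ 0`. Substituting `c / √(1 + δ)` for `c` gives
`c⋆ f(a) c ≤ (1 + δ) f(c⋆ a c)`, where `δ → 0` is harmless.

For the last assertion, a multiple of a projection of rank `k ≥ 1` on an infinite-dimensional space
has an eigenvector with eigenvalue `t`, for any given `t ≥ 0`; there `φ(a) = g(a)` says
`f_k(t) = g(t)` (`apply_eigenvalue_eq_of_borelCalculus_eq_cfc`).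
-/

/-! ### Spectral measures and intertwining operators -/

section

variable {H K L : Type*} [NormedAddCommGroup H] [InnerProductSpace ℂ H]
  [NormedAddCommGroup K] [InnerProductSpace ℂ K] [NormedAddCommGroup L] [InnerProductSpace ℂ L]

theorem pow_apply_of_intertwine {S : H →L[ℂ] K} {p : H →L[ℂ] H} {a : K →L[ℂ] K}
    (h : ∀ x, S (p x) = a (S x)) (n : ℕ) (x : H) : S ((p ^ n) x) = (a ^ n) (S x) := by
  induction n generalizing x with
  | zero => simp
  | succ k ih =>
    rw [pow_succ, pow_succ, mul_apply_eq_comp, ih, h, mul_apply_eq_comp]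

theorem aeval_apply_of_intertwine {S : H →L[ℂ] K} {p : H →L[ℂ] H} {a : K →L[ℂ] K}
    (h : ∀ x, S (p x) = a (S x)) (q : Polynomial ℝ) (x : H) :
    S (Polynomial.aeval p q x) = Polynomial.aeval a q (S x) := by
  induction q using Polynomial.induction_on' with
  | add q r hq hr => simp [hq, hr]
  | monomial n r =>
    rw [Polynomial.aeval_monomial, Polynomial.aeval_monomial, ← Algebra.smul_def,
      ← Algebra.smul_def, smul_apply, smul_apply,
      ← pow_apply_of_intertwine h, ← Complex.coe_smul, ← Complex.coe_smul, map_smul]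

variable [CompleteSpace H] [CompleteSpace K] [CompleteSpace L]

theorem abs_le_norm_of_mem_spectrum {a : H →L[ℂ] H} (ha : IsSelfAdjoint a) {t : ℝ}
    (ht : t ∈ spectrum ℝ a) : |t| ≤ ‖a‖ := by
  rcases subsingleton_or_nontrivial (H →L[ℂ] H) with _ | _
  · simp [spectrum.of_subsingleton] at ht
  · exact IsometricContinuousFunctionalCalculus.norm_spectrum_le a ht ha

theorem norm_cfc_sub_aeval_le {a : H →L[ℂ] H} (ha : IsSelfAdjoint a) {R ε : ℝ} (haR : ‖a‖ ≤ R)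
    (hε : 0 ≤ ε) {g : ℝ → ℝ} (hg : Continuous g) {q : Polynomial ℝ}
    (hq : ∀ t ∈ Set.Icc (-R) R, |q.eval t - g t| < ε) :
    ‖cfc g a - Polynomial.aeval a q‖ ≤ ε := by
  rw [← cfc_polynomial q a ha, ← cfc_sub g q.eval a hg.continuousOn q.continuous.continuousOn]
  refine norm_cfc_le hε fun t ht => ?_
  rw [norm_sub_rev]
  exact (hq t (abs_le.1 ((abs_le_norm_of_mem_spectrum ha ht).trans haR))).le

/-- Intertwiners of self-adjoint operators intertwine their continuous functional calculi: this
is clear for polynomials, and these are dense. -/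
theorem cfc_apply_of_intertwine {S : H →L[ℂ] K} {p : H →L[ℂ] H} {a : K →L[ℂ] K}
    (hp : IsSelfAdjoint p) (ha : IsSelfAdjoint a) (h : ∀ x, S (p x) = a (S x))
    {g : ℝ → ℝ} (hg : Continuous g) (x : H) :
    S (cfc g p x) = cfc g a (S x) := by
  have approx : ∀ ε > 0, ‖S (cfc g p x) - cfc g a (S x)‖ ≤ 2 * ‖S‖ * ‖x‖ * ε := by
    intro ε hε
    obtain ⟨q, hq⟩ := exists_polynomial_near_of_continuousOn (-max ‖p‖ ‖a‖) (max ‖p‖ ‖a‖) g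
      hg.continuousOn ε hε
    have h1 := norm_cfc_sub_aeval_le hp (le_max_left _ _) hε.le hg hq
    have h2 := norm_cfc_sub_aeval_le ha (le_max_right _ _) hε.le hg hq
    have h3 : S (cfc g p x) - cfc g a (S x) =
        S ((cfc g p - Polynomial.aeval p q) x) - (cfc g a - Polynomial.aeval a q) (S x) := by
      simp only [sub_apply, map_sub, aeval_apply_of_intertwine h]
      abel
    rw [h3]
    calc _ ≤ ‖S‖ * (ε * ‖x‖) + ε * (‖S‖ * ‖x‖) := by
          refine (norm_sub_le _ _).trans (add_le_add ?_ ?_)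
          · exact S.le_opNorm_of_le (ContinuousLinearMap.le_of_opNorm_le _ h1 x)
          · exact (ContinuousLinearMap.le_of_opNorm_le _ h2 _).trans
              (by gcongr; exact S.le_opNorm x)
      _ = _ := by ring
  rw [← sub_eq_zero, ← norm_le_zero_iff]
  refine ge_of_tendsto (x := 𝓝[>] (0 : ℝ)) (f := fun ε => 2 * ‖S‖ * ‖x‖ * ε) ?_ ?_
  · refine Tendsto.mono_left ?_ nhdsWithin_le_nhds
    exact (continuous_const.mul continuous_id).tendsto' 0 0 (by simp)
  · filter_upwards [self_mem_nhdsWithin] with ε hε using approx ε hε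

/-- Isometries that intertwine self-adjoint operators preserve spectral measures. -/
theorem spectralMeasure_of_intertwine {V : H →L[ℂ] K} {p : H →L[ℂ] H} {a : K →L[ℂ] K}
    (hp : IsSelfAdjoint p) (ha : IsSelfAdjoint a) (h : ∀ x, V (p x) = a (V x))
    (hV : ∀ x y, inner ℂ (V x) (V y) = inner ℂ x y) (x : H) :
    spectralMeasure a (V x) = spectralMeasure p x := by
  refine Measure.ext_of_integral_eq_on_compactlySupported fun g => ?_
  have hg : Continuous fun t => g t := g.continuous
  rw [integral_spectralMeasure, integral_spectralMeasure,
    ← cfc_apply_of_intertwine hp ha h hg, hV]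

/-- The spectral measure of a block-diagonal operator is the sum of those of its blocks; `V` and
`W` are the inclusions of the two summands. -/
theorem spectralMeasure_add_of_intertwine {V : H →L[ℂ] K} {W : L →L[ℂ] K} {p : H →L[ℂ] H}
    {q : L →L[ℂ] L} {a : K →L[ℂ] K}
    (hp : IsSelfAdjoint p) (hq : IsSelfAdjoint q) (ha : IsSelfAdjoint a)
    (hVp : ∀ x, V (p x) = a (V x)) (hWq : ∀ x, W (q x) = a (W x))
    (hV : ∀ x y, inner ℂ (V x) (V y) = inner ℂ x y)
    (hW : ∀ x y, inner ℂ (W x) (W y) = inner ℂ x y)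
    (hVW : ∀ x y, inner ℂ (V x) (W y) = 0) (x : H) (y : L) :
    spectralMeasure a (V x + W y) = spectralMeasure p x + spectralMeasure q y := by
  refine Measure.ext_of_integral_eq_on_compactlySupported fun g => ?_
  have hg : Continuous fun t => g t := g.continuous
  have hWV : ∀ x y, inner ℂ (W y) (V x) = 0 := fun x y => by
    rw [← inner_conj_symm, hVW, map_zero]
  rw [integral_add_measure (hg.integrable_of_hasCompactSupport g.hasCompactSupport)
    (hg.integrable_of_hasCompactSupport g.hasCompactSupport)]
  simp only [integral_spectralMeasure]
  rw [map_add, ← cfc_apply_of_intertwine hp ha hVp hg,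
    ← cfc_apply_of_intertwine hq ha hWq hg]
  simp [inner_add_left, inner_add_right, hV, hW, hVW, hWV]

/-- The spectral measure at an eigenvector is a point mass at the eigenvalue. -/
theorem integral_spectralMeasure_eigenvector {a : H →L[ℂ] H} (ha : IsSelfAdjoint a) {x : H}
    {t : ℝ} (hx : a x = t • x) (f : ℝ → ℝ) :
    ∫ s, f s ∂(spectralMeasure a x) = ‖x‖ ^ 2 * f t := by
  have hcfc : ∀ g : ℝ → ℝ, Continuous g → cfc g a x = g t • x := fun g hg => by
    have h := cfc_apply_of_intertwine (S := ContinuousLinearMap.toSpanSingleton ℂ x)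
      (p := algebraMap ℝ (ℂ →L[ℂ] ℂ) t) (a := a) (cfc_predicate_algebraMap t) ha
      (fun z => by
        simp [Algebra.algebraMap_eq_smul_one, hx, smul_smul, mul_comm, mul_smul]) hg 1
    rw [cfc_algebraMap] at h
    simpa [Algebra.algebraMap_eq_smul_one] using h.symm
  have hm : spectralMeasure a x = (‖x‖₊ ^ 2) • Measure.dirac t := by
    refine Measure.ext_of_integral_eq_on_compactlySupported fun g => ?_
    have hg : Continuous fun t => g t := g.continuous
    rw [integral_spectralMeasure, hcfc _ hg, integral_smul_nnreal_measure,
      integral_dirac, inner_smul_right_eq_smul, Complex.smul_re, ← RCLike.re_eq_complex_re,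
      inner_self_eq_norm_sq]
    simp [NNReal.smul_def, mul_comm]
  rw [hm, integral_smul_nnreal_measure, integral_dirac]
  simp [NNReal.smul_def]

end

/-! ### The Borel calculus of positive operators, and their rank -/

section

variable {H : Type*} [NormedAddCommGroup H] [InnerProductSpace ℂ H]

theorem re_inner_self_nonneg {a : H →L[ℂ] H} (ha : 0 ≤ a) (x : H) :
    0 ≤ (inner ℂ x (a x)).re :=
  ((ContinuousLinearMap.nonneg_iff_isPositive a).1 ha).re_inner_nonneg_right x

/-- Peter–Paul inequality for the positive form `⟪x, a x⟫`. -/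
theorem re_inner_add_le {a : H →L[ℂ] H} (ha : 0 ≤ a) {δ : ℝ} (hδ : 0 < δ) (x y : H) :
    (inner ℂ (x + y) (a (x + y))).re ≤
      (1 + δ) * (inner ℂ x (a x)).re + (1 + δ⁻¹) * (inner ℂ y (a y)).re := by
  -- `δ⁻¹ ⟪δx - y, a (δx - y)⟫ ≥ 0` is the difference of the two sides.
  have h := mul_nonneg (inv_nonneg.2 hδ.le) (re_inner_self_nonneg ha ((δ : ℂ) • x - y))
  simp only [map_add, map_sub, map_smul, inner_add_left, inner_add_right, inner_sub_left,
    inner_sub_right, inner_smul_left, inner_smul_right, Complex.conj_ofReal, Complex.add_re,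
    Complex.sub_re, Complex.re_ofReal_mul] at h ⊢
  field_simp at h ⊢
  linarith

theorem nonneg_of_inner_eq_ofReal {T : H →L[ℂ] H} {r : H → ℝ}
    (hT : ∀ x, inner ℂ x (T x) = (r x : ℂ)) (hr : ∀ x, 0 ≤ r x) : 0 ≤ T := by
  rw [ContinuousLinearMap.nonneg_iff_isPositive, ContinuousLinearMap.isPositive_iff_complex]
  intro x
  have h : inner ℂ (T x) x = (r x : ℂ) := by
    rw [← inner_conj_symm, hT, Complex.conj_ofReal]
  simp [h, hr]

variable [CompleteSpace H]

theorem re_inner_le_of_le {a b : H →L[ℂ] H} (hab : a ≤ b) (x : H) :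
    (inner ℂ x (a x)).re ≤ (inner ℂ x (b x)).re := by
  have := re_inner_self_nonneg (sub_nonneg.2 hab) x
  simp [inner_sub_right] at this
  exact this

theorem le_of_re_inner_le {a b : H →L[ℂ] H} (ha : IsSelfAdjoint a) (hb : IsSelfAdjoint b)
    (h : ∀ x, (inner ℂ x (a x)).re ≤ (inner ℂ x (b x)).re) : a ≤ b := by
  rw [ContinuousLinearMap.le_def, ContinuousLinearMap.isPositive_def']
  refine ⟨hb.sub ha, fun x => ?_⟩
  rw [ContinuousLinearMap.reApplyInnerSelf_apply, inner_re_symm, sub_apply,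
    inner_sub_right, map_sub]
  exact sub_nonneg.2 (h x)

theorem ker_antitone {a b : H →L[ℂ] H} (ha : 0 ≤ a) (hab : a ≤ b) : b.ker ≤ a.ker := by
  intro x hx
  have hx' : b x = 0 := hx
  obtain ⟨s, rfl⟩ := CStarAlgebra.nonneg_iff_eq_star_mul_self.1 ha
  have h1 := re_inner_le_of_le hab x
  rw [hx', inner_zero_right, mul_apply_eq_comp, ContinuousLinearMap.star_eq_adjoint,
    ContinuousLinearMap.adjoint_inner_right, ← RCLike.re_eq_complex_re, inner_self_eq_norm_sq] at h1
  have h2 : s x = 0 := by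
    have : ‖s x‖ ^ 2 ≤ 0 := h1
    simpa using this
  simp [h2]

theorem measurable_domRestrict_of_monotoneOn {f : ℝ → ℝ} (hf : MonotoneOn f (Set.Ici 0))
    {a : H →L[ℂ] H} (ha : 0 ≤ a) : Measurable ((spectrum ℝ a).domRestrict f) := by
  have h1 : Monotone fun t => f (max 0 t) := fun s t hst =>
    hf (le_max_left 0 s) (le_max_left 0 t) (max_le_max_left 0 hst)
  have h2 : (spectrum ℝ a).domRestrict f = fun t : spectrum ℝ a => f (max 0 (t : ℝ)) := by
    ext t
    rw [max_eq_right (spectrum_nonneg_of_nonneg ha t.2)]; rfl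
  rw [h2]
  exact h1.measurable.comp measurable_subtype_coe

theorem abs_le_of_monotoneOn {f : ℝ → ℝ} (hf : MonotoneOn f (Set.Ici 0)) {a : H →L[ℂ] H}
    (ha : 0 ≤ a) : ∀ t ∈ spectrum ℝ a, |f t| ≤ max |f 0| |f ‖a‖| := by
  intro t ht
  have h0 : 0 ≤ t := spectrum_nonneg_of_nonneg ha ht
  have h1 : t ≤ ‖a‖ := (le_abs_self t).trans (abs_le_norm_of_mem_spectrum (.of_nonneg ha) ht)
  exact abs_le_max_abs_abs (hf (Set.self_mem_Ici) h0 h0) (hf h0 (norm_nonneg a) h1)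

theorem inner_borelCalculus_of_monotoneOn {f : ℝ → ℝ} (hf : MonotoneOn f (Set.Ici 0))
    {a : H →L[ℂ] H} (ha : 0 ≤ a) (x : H) :
    inner ℂ x (borelCalculus f a x) = ((∫ t, f t ∂(spectralMeasure a x) : ℝ) : ℂ) :=
  inner_borelCalculus (measurable_domRestrict_of_monotoneOn hf ha) (abs_le_of_monotoneOn hf ha) x

theorem integrable_of_monotoneOn {f : ℝ → ℝ} (hf : MonotoneOn f (Set.Ici 0)) {a : H →L[ℂ] H}
    (ha : 0 ≤ a) (x : H) : Integrable f (spectralMeasure a x) :=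
  integrable_spectralMeasure (measurable_domRestrict_of_monotoneOn hf ha)
    (abs_le_of_monotoneOn hf ha) x

theorem ae_nonneg_spectralMeasure (a : H →L[ℂ] H) (ha : 0 ≤ a) (x : H) :
    ∀ᵐ t ∂(spectralMeasure a x), 0 ≤ t := by
  filter_upwards [ae_mem_spectrum a x] with t ht using spectrum_nonneg_of_nonneg ha ht

theorem borelCalculus_le_iff {f g : ℝ → ℝ} (hf : MonotoneOn f (Set.Ici 0))
    (hg : MonotoneOn g (Set.Ici 0)) {a b : H →L[ℂ] H} (ha : 0 ≤ a) (hb : 0 ≤ b) :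
    borelCalculus f a ≤ borelCalculus g b ↔
      ∀ x, ∫ t, f t ∂(spectralMeasure a x) ≤ ∫ t, g t ∂(spectralMeasure b x) := by
  refine ⟨fun h x => ?_, fun h => ?_⟩
  · have := re_inner_le_of_le h x
    rwa [inner_borelCalculus_of_monotoneOn hf ha, inner_borelCalculus_of_monotoneOn hg hb,
      Complex.ofReal_re, Complex.ofReal_re] at this
  · rw [← sub_nonneg]
    refine nonneg_of_inner_eq_ofReal (r := fun x => ∫ t, g t ∂(spectralMeasure b x) -
      ∫ t, f t ∂(spectralMeasure a x)) (fun x => ?_) fun x => sub_nonneg.2 (h x)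
    rw [sub_apply, inner_sub_right, inner_borelCalculus_of_monotoneOn hf ha,
      inner_borelCalculus_of_monotoneOn hg hb, Complex.ofReal_sub]

/-- The closure of the range of a self-adjoint operator is the orthogonal complement of its kernel,
so this is `ker_antitone`. -/
theorem operatorRank_mono {a b : H →L[ℂ] H} (ha : 0 ≤ a) (hab : a ≤ b) :
    operatorRank a ≤ operatorRank b := by
  have h := Submodule.orthogonal_le (ker_antitone ha hab)
  rw [ContinuousLinearMap.orthogonal_ker, ContinuousLinearMap.orthogonal_ker,
    (IsSelfAdjoint.of_nonneg ha).adjoint_eq,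
    (IsSelfAdjoint.of_nonneg (ha.trans hab)).adjoint_eq] at h
  exact (OrderHomClass.mono Cardinal.toENat) (Submodule.rank_mono h)

/-- The operator `c⋆` is injective and maps the closure of `a H` into that of `c⋆ a c H`. -/
theorem operatorRank_le_conj {c : H →L[ℂ] H} (hc : IsUnit c) (a : H →L[ℂ] H) :
    operatorRank a ≤ operatorRank (star c * a * c) := by
  obtain ⟨d, hd⟩ := hc.exists_right_inv
  have hd' : ∀ x, c (d x) = x := fun x => by
    rw [← mul_apply_eq_comp, hd, one_apply_eq_self]
  have hinj : Function.Injective (star c : H →L[ℂ] H) := by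
    intro x y hxy
    have h : star d * star c = 1 := by rw [← star_mul, hd, star_one]
    have := congrArg (star d : H →L[ℂ] H) hxy
    rwa [← mul_apply_eq_comp, ← mul_apply_eq_comp, h] at this
  have hmaps : ∀ x ∈ (LinearMap.range (a : H →ₗ[ℂ] H)).topologicalClosure,
      (star c : H →L[ℂ] H) x ∈
        (LinearMap.range ((star c * a * c : H →L[ℂ] H) : H →ₗ[ℂ] H)).topologicalClosure := by
    intro x hx
    refine map_mem_closure (star c : H →L[ℂ] H).continuous hx ?_
    rintro _ ⟨z, rfl⟩
    exact ⟨d z, by simp [hd']⟩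
  exact (OrderHomClass.mono Cardinal.toENat) (LinearMap.rank_le_of_injective
    (((star c : H →L[ℂ] H) : H →ₗ[ℂ] H).restrict hmaps) fun x y hxy =>
      Subtype.ext (hinj (congrArg Subtype.val hxy)))

end

/-! ### Block operators and unitary dilations -/

section

theorem forall_withLp_prod {E : Type*} {P : WithLp 2 (E × E) → Prop} :
    (∀ z, P z) ↔ ∀ x y, P (WithLp.toLp 2 (x, y)) :=
  ⟨fun h _ _ => h _, fun h z => h z.fst z.snd⟩

variable {H : Type*} [NormedAddCommGroup H] [InnerProductSpace ℂ H]

/-- The operator on the Hilbert sum `H ⊕ H` with block matrix `(a, b; c, d)`. -/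
noncomputable def blockOp (a b c d : H →L[ℂ] H) : WithLp 2 (H × H) →L[ℂ] WithLp 2 (H × H) :=
  (WithLp.prodContinuousLinearEquiv 2 ℂ H H).symm ∘L
    ((a.coprod b).prod (c.coprod d)) ∘L (WithLp.prodContinuousLinearEquiv 2 ℂ H H)

theorem blockOp_apply (a b c d : H →L[ℂ] H) (x y : H) :
    blockOp a b c d (WithLp.toLp 2 (x, y)) = WithLp.toLp 2 (a x + b y, c x + d y) := by
  simp [blockOp]

/-- The inclusion of the first summand of `H ⊕ H`. -/
noncomputable def blockInl : H →L[ℂ] WithLp 2 (H × H) :=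
  (WithLp.prodContinuousLinearEquiv 2 ℂ H H).symm ∘L ContinuousLinearMap.inl ℂ H H

/-- The inclusion of the second summand of `H ⊕ H`. -/
noncomputable def blockInr : H →L[ℂ] WithLp 2 (H × H) :=
  (WithLp.prodContinuousLinearEquiv 2 ℂ H H).symm ∘L ContinuousLinearMap.inr ℂ H H

theorem blockInl_apply (x : H) : blockInl x = WithLp.toLp 2 (x, 0) := by simp [blockInl]

theorem blockInr_apply (x : H) : blockInr x = WithLp.toLp 2 (0, x) := by simp [blockInr]

theorem blockOp_mul (a b c d a' b' c' d' : H →L[ℂ] H) : blockOp a b c d * blockOp a' b' c' d' =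
    blockOp (a * a' + b * c') (a * b' + b * d') (c * a' + d * c') (c * b' + d * d') := by
  refine ContinuousLinearMap.ext (forall_withLp_prod.2 fun x y => ?_)
  simp [blockOp_apply]
  constructor <;> abel

theorem blockOp_one : blockOp (1 : H →L[ℂ] H) 0 0 1 = 1 :=
  ContinuousLinearMap.ext (forall_withLp_prod.2 fun x y => by simp [blockOp_apply])

theorem inner_blockInl_blockInl (x y : H) :
    inner ℂ (blockInl x) (blockInl y) = (inner ℂ x y : ℂ) := by
  simp [blockInl_apply]

theorem inner_blockInr_blockInr (x y : H) :
    inner ℂ (blockInr x) (blockInr y) = (inner ℂ x y : ℂ) := by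
  simp [blockInr_apply]

theorem inner_blockInl_blockInr (x y : H) :
    inner ℂ (blockInl x) (blockInr y) = (0 : ℂ) := by
  simp [blockInl_apply, blockInr_apply]

theorem blockOp_blockInl (a b c d : H →L[ℂ] H) (x : H) :
    blockOp a b c d (blockInl x) = blockInl (a x) + blockInr (c x) := by
  simp [blockInl_apply, blockInr_apply, blockOp_apply, ← WithLp.toLp_add]

theorem blockOp_blockInr (a b c d : H →L[ℂ] H) (x : H) :
    blockOp a b c d (blockInr x) = blockInl (b x) + blockInr (d x) := by
  simp [blockInl_apply, blockInr_apply, blockOp_apply, ← WithLp.toLp_add]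

variable [CompleteSpace H]

open ContinuousLinearMap in
theorem star_blockOp (a b c d : H →L[ℂ] H) :
    star (blockOp a b c d) = blockOp (star a) (star c) (star b) (star d) := by
  rw [star_eq_adjoint, eq_comm, eq_adjoint_iff, forall_withLp_prod]
  intro x y
  rw [forall_withLp_prod]
  intro z w
  simp [blockOp_apply, inner_add_left, inner_add_right, star_eq_adjoint, adjoint_inner_left]
  ring

/-- Halmos' dilation of a contraction `c` to a unitary operator on `H ⊕ H`: the defect operators
`√(1 - c⋆c)` and `√(1 - cc⋆)` are intertwined by `c`. -/
theorem exists_unitary_dilation {c : H →L[ℂ] H} (hc : ‖c‖ ≤ 1) :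
    ∃ d e : H →L[ℂ] H,
      star (blockOp c d e (-star c)) * blockOp c d e (-star c) = 1 ∧
      blockOp c d e (-star c) * star (blockOp c d e (-star c)) = 1 := by
  have hsq : ∀ b : H →L[ℂ] H, 0 ≤ b → cfc Real.sqrt b * cfc Real.sqrt b = b := fun b hb => by
    rw [← cfc_mul Real.sqrt Real.sqrt b, cfc_congr (g := fun t => t)
      (fun t ht => Real.mul_self_sqrt (spectrum_nonneg_of_nonneg hb ht)), cfc_id' ℝ b]
  have h1 : ∀ b : H →L[ℂ] H, ‖b‖ ≤ 1 → 0 ≤ 1 - star b * b := fun b hb => by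
    refine nonneg_of_inner_eq_ofReal (r := fun x => ‖x‖ ^ 2 - ‖b x‖ ^ 2) (fun x => ?_) fun x => ?_
    · simp [inner_sub_right, ContinuousLinearMap.star_eq_adjoint,
        ContinuousLinearMap.adjoint_inner_right, inner_self_eq_norm_sq_to_K]
    · rw [sub_nonneg]
      gcongr
      simpa using b.le_of_opNorm_le hb x
  have hE := h1 c hc
  have hD := h1 (star c) (by rwa [norm_star])
  rw [star_star] at hD
  obtain ⟨d, hd⟩ : ∃ d, d = cfc Real.sqrt (1 - c * star c) := ⟨_, rfl⟩
  obtain ⟨e, he⟩ : ∃ e, e = cfc Real.sqrt (1 - star c * c) := ⟨_, rfl⟩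
  have hdsa : star d = d := by rw [hd]; exact cfc_predicate Real.sqrt (1 - c * star c)
  have hesa : star e = e := by rw [he]; exact cfc_predicate Real.sqrt (1 - star c * c)
  have hdd : d * d = 1 - c * star c := by rw [hd, hsq _ hD]
  have hee : e * e = 1 - star c * c := by rw [he, hsq _ hE]
  have hce : c * e = d * c := by
    rw [hd, he]
    ext x
    exact cfc_apply_of_intertwine (IsSelfAdjoint.of_nonneg hE) (IsSelfAdjoint.of_nonneg hD)
      (fun x => by simp) Real.continuous_sqrt x
  have hec : e * star c = star c * d := by
    rw [← hesa, ← hdsa, ← star_mul, ← star_mul, hce]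
  refine ⟨d, e, ?_, ?_⟩ <;>
    rw [star_blockOp, blockOp_mul, ← blockOp_one] <;>
    congr 1 <;> simp [hdsa, hesa, hdd, hee, hce, hec]

end

/-! ### Hansen's inequality -/

section

/-- This is operator monotonicity for scalar operators on the one-dimensional Hilbert space
`EuclideanSpace ℂ PUnit`, which exists in every universe. -/
theorem OperatorMonotone.monotoneOn {f : ℝ → ℝ} (hf : OperatorMonotone.{u} f) :
    MonotoneOn f (Set.Ici 0) := by
  intro s hs t _ hst
  have h := hf (EuclideanSpace ℂ PUnit.{u + 1}) (algebraMap ℝ _ s) (algebraMap ℝ _ t)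
    (algebraMap_nonneg _ hs) (algebraMap_mono _ hst)
  rw [borelCalculus_eq_cfc (((Set.finite_singleton s).subset
      (CFC.spectrum_algebraMap_subset s)).continuousOn f),
    borelCalculus_eq_cfc (((Set.finite_singleton t).subset
      (CFC.spectrum_algebraMap_subset t)).continuousOn f),
    cfc_algebraMap, cfc_algebraMap] at h
  have h1 := re_inner_le_of_le h (EuclideanSpace.single PUnit.unit 1)
  simpa [Algebra.algebraMap_eq_smul_one, inner_smul_right_eq_smul] using h1

variable {H : Type u} [NormedAddCommGroup H] [InnerProductSpace ℂ H] [CompleteSpace H]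

/-- Comparison of `a ⊕ 0`, conjugated by the unitary dilation of `c`, with a block-diagonal
operator. The factor `1 + δ` in the first corner is the price for killing the off-diagonal part. -/
theorem integral_spectralMeasure_apply_le {f : ℝ → ℝ} (hf : OperatorMonotone.{u} f)
    (hpos : ∀ t, 0 ≤ t → 0 ≤ f t) {c : H →L[ℂ] H} (hc : ‖c‖ ≤ 1) {a : H →L[ℂ] H} (ha : 0 ≤ a)
    {δ : ℝ} (hδ : 0 < δ) (x : H) :
    ∫ t, f t ∂(spectralMeasure a (c x)) ≤
      ∫ t, f t ∂(spectralMeasure ((1 + δ) • (star c * a * c)) x) := by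
  have hm := hf.monotoneOn
  obtain ⟨d, e, hU1, hU2⟩ := exists_unitary_dilation hc
  obtain ⟨U, hU⟩ : ∃ U, U = blockOp c d e (-star c) := ⟨_, rfl⟩
  rw [← hU] at hU1 hU2
  obtain ⟨p, hp⟩ : ∃ p, p = (1 + δ) • (star c * a * c) := ⟨_, rfl⟩
  obtain ⟨q, hq⟩ : ∃ q, q = (1 + δ⁻¹) • (star d * a * d) := ⟨_, rfl⟩
  have hp0 : 0 ≤ p := hp ▸ smul_nonneg (by positivity) (star_left_conjugate_nonneg ha c)
  have hq0 : 0 ≤ q := hq ▸ smul_nonneg (by positivity) (star_left_conjugate_nonneg ha d)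
  have hasa := IsSelfAdjoint.of_nonneg ha
  have hpsa := IsSelfAdjoint.of_nonneg hp0
  have hqsa := IsSelfAdjoint.of_nonneg hq0
  obtain ⟨A, hA⟩ : ∃ A, A = blockOp a 0 0 0 := ⟨_, rfl⟩
  obtain ⟨D, hD⟩ : ∃ D, D = blockOp p 0 0 q := ⟨_, rfl⟩
  have hAsa : IsSelfAdjoint A := by simp [hA, IsSelfAdjoint, star_blockOp, hasa.star_eq]
  have hDsa : IsSelfAdjoint D := by
    simp [hD, IsSelfAdjoint, star_blockOp, hpsa.star_eq, hqsa.star_eq]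
  have hA0 : 0 ≤ A := le_of_re_inner_le (IsSelfAdjoint.zero _) hAsa
    (forall_withLp_prod.2 fun y z => by
      simpa [hA, blockOp_apply] using re_inner_self_nonneg ha y)
  have hB0 : 0 ≤ star U * A * U := star_left_conjugate_nonneg hA0 U
  have hBsa := IsSelfAdjoint.of_nonneg hB0
  -- The form of `U⋆ A U` at `(y, z)` is `⟪c y + d z, a (c y + d z)⟫`.
  have hBD : star U * A * U ≤ D := by
    refine le_of_re_inner_le hBsa hDsa (forall_withLp_prod.2 fun y z => ?_)
    rw [mul_apply_eq_comp, mul_apply_eq_comp, ContinuousLinearMap.star_eq_adjoint,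
      ContinuousLinearMap.adjoint_inner_right]
    simp only [hU, hA, hD, hp, hq, blockOp_apply]
    have h := re_inner_add_le ha hδ (c y) (d z)
    simp [ContinuousLinearMap.star_eq_adjoint, ContinuousLinearMap.adjoint_inner_right,
      inner_smul_right_eq_smul]
    rw [← map_add]
    exact h
  have hAl : ∀ y, blockInl (a y) = A (blockInl y) := fun y => by simp [hA, blockOp_blockInl]
  have hAr : ∀ y, blockInr ((0 : H →L[ℂ] H) y) = A (blockInr y) := fun y => by
    simp [hA, blockOp_blockInr]
  have hDl : ∀ y, blockInl (p y) = D (blockInl y) := fun y => by simp [hD, blockOp_blockInl]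
  have hUB : ∀ y, U ((star U * A * U) y) = A (U y) := fun y => by
    rw [← mul_apply_eq_comp, ← mul_assoc, ← mul_assoc, hU2, one_mul, mul_apply_eq_comp]
  have hUU : ∀ y z, inner ℂ (U y) (U z) = inner ℂ y z := fun y z => by
    rw [← ContinuousLinearMap.adjoint_inner_right, ← ContinuousLinearMap.star_eq_adjoint,
      ← mul_apply_eq_comp, hU1, one_apply_eq_self]
  rw [← hp]
  calc ∫ t, f t ∂(spectralMeasure a (c x))
      ≤ ∫ t, f t ∂(spectralMeasure a (c x) + spectralMeasure 0 (e x)) := by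
        -- The second measure is a multiple of the point mass at `0`, where `f` is nonnegative.
        rw [integral_add_measure (integrable_of_monotoneOn hm ha _)
          (integrable_of_monotoneOn hm le_rfl _)]
        refine le_add_of_nonneg_right (integral_nonneg_of_ae ?_)
        filter_upwards [ae_nonneg_spectralMeasure (0 : H →L[ℂ] H) le_rfl (e x)] with t ht
          using hpos t ht
    _ = ∫ t, f t ∂(spectralMeasure A (U (blockInl x))) := by
        rw [hU, blockOp_blockInl, spectralMeasure_add_of_intertwine hasa (IsSelfAdjoint.zero _)
          hAsa hAl hAr inner_blockInl_blockInl inner_blockInr_blockInr inner_blockInl_blockInr]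
    _ = ∫ t, f t ∂(spectralMeasure (star U * A * U) (blockInl x)) := by
        rw [spectralMeasure_of_intertwine hBsa hAsa hUB hUU]
    _ ≤ ∫ t, f t ∂(spectralMeasure D (blockInl x)) :=
        (borelCalculus_le_iff hm hm hB0 (hB0.trans hBD)).1 (hf _ _ _ hB0 hBD) _
    _ = ∫ t, f t ∂(spectralMeasure p x) := by
        rw [spectralMeasure_of_intertwine hpsa hDsa hDl inner_blockInl_blockInl]

/-- Hansen's inequality. Dividing `c` by `√(1 + δ)` in `integral_spectralMeasure_apply_le` moves the
factor `1 + δ` out of `f`, so that no continuity of `f` is needed to let `δ → 0`. -/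
theorem OperatorMonotone.conj_borelCalculus_le {f : ℝ → ℝ} (hf : OperatorMonotone.{u} f)
    (hpos : ∀ t, 0 ≤ t → 0 ≤ f t) {c : H →L[ℂ] H} (hc : ‖c‖ ≤ 1) {a : H →L[ℂ] H} (ha : 0 ≤ a) :
    star c * borelCalculus f a * c ≤ borelCalculus f (star c * a * c) := by
  have hm := hf.monotoneOn
  have hb : 0 ≤ star c * a * c := star_left_conjugate_nonneg ha c
  rw [← sub_nonneg]
  have hx : ∀ x, inner ℂ x ((star c * borelCalculus f a * c) x) =
      ((∫ t, f t ∂(spectralMeasure a (c x)) : ℝ) : ℂ) := fun x => by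
    rw [mul_apply_eq_comp, mul_apply_eq_comp, ContinuousLinearMap.star_eq_adjoint,
      ContinuousLinearMap.adjoint_inner_right, inner_borelCalculus_of_monotoneOn hm ha]
  refine nonneg_of_inner_eq_ofReal (r := fun x => ∫ t, f t ∂(spectralMeasure (star c * a * c) x) -
    ∫ t, f t ∂(spectralMeasure a (c x))) (fun x => ?_) fun x => sub_nonneg.2 ?_
  · rw [sub_apply, inner_sub_right, hx, inner_borelCalculus_of_monotoneOn hm hb,
      Complex.ofReal_sub]
  obtain ⟨I, hI⟩ : ∃ I : H → ℝ, ∀ y, ∫ t, f t ∂(spectralMeasure a y) = I y := ⟨_, fun _ => rfl⟩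
  have key : ∀ δ > 0, I (c x) ≤ (1 + δ) * ∫ t, f t ∂(spectralMeasure (star c * a * c) x) := by
    intro δ hδ
    obtain ⟨r, hr⟩ : ∃ r, r = (√(1 + δ))⁻¹ := ⟨_, rfl⟩
    have hr2 : r * r = (1 + δ)⁻¹ := by
      rw [hr, ← mul_inv, Real.mul_self_sqrt (by positivity)]
    have hr0 : 0 ≤ r := by rw [hr]; positivity
    have hr1 : r ≤ 1 := by
      rw [hr]; exact inv_le_one_of_one_le₀ (Real.one_le_sqrt.2 (by linarith))
    have hrc : ‖r • c‖ ≤ 1 := by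
      rw [norm_smul, Real.norm_of_nonneg hr0]
      exact mul_le_one₀ hr1 (norm_nonneg c) hc
    have h := integral_spectralMeasure_apply_le hf hpos hrc ha hδ x
    have h1 : (1 + δ) • (star (r • c) * a * (r • c)) = star c * a * c := by
      rw [star_smul, star_trivial, smul_mul_assoc, smul_mul_assoc, mul_smul_comm, smul_smul,
        smul_smul, mul_assoc, hr2, mul_inv_cancel₀ (by positivity), one_smul]
    have h2 : I ((r • c) x) = (1 + δ)⁻¹ * I (c x) := by
      have e := inner_borelCalculus_of_monotoneOn hm ha ((r • c) x)
      rw [smul_apply, ← Complex.coe_smul, map_smul, Complex.coe_smul, Complex.coe_smul,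
        inner_smul_right_eq_smul, inner_smul_left_eq_smul,
        inner_borelCalculus_of_monotoneOn hm ha, smul_smul, hr2, hI, ← smul_apply, hI,
        Complex.real_smul] at e
      exact_mod_cast e.symm
    rw [h1, hI, h2, inv_mul_le_iff₀ (by positivity)] at h
    exact h
  rw [hI]
  refine ge_of_tendsto (x := 𝓝[>] (0 : ℝ))
    (f := fun δ => (1 + δ) * ∫ t, f t ∂(spectralMeasure (star c * a * c) x)) ?_ ?_
  · refine Tendsto.mono_left ?_ nhdsWithin_le_nhds
    exact ((continuous_const.add continuous_id).mul continuous_const).tendsto' 0 _ (by simp)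
  · filter_upwards [self_mem_nhdsWithin] with δ hδ using key δ hδ

end

/-! ### Limits and the index set `{0, 1, …, ∞}` -/

section

/-- A pointwise limit of an increasing sequence of operator monotone functions is operator monotone,
by dominated convergence for the spectral measures. -/
theorem OperatorMonotone.of_tendsto {f : ℕ → ℝ → ℝ} {g : ℝ → ℝ}
    (hf : ∀ n, OperatorMonotone.{u} (f n))
    (hincr : ∀ t, 0 ≤ t → Monotone fun n => f n t)
    (hlim : ∀ t, 0 ≤ t → Tendsto (fun n => f n t) atTop (𝓝 (g t))) :
    OperatorMonotone.{u} g := by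
  have hm := fun n => (hf n).monotoneOn
  have hg : MonotoneOn g (Set.Ici 0) := fun s hs t ht hst =>
    le_of_tendsto_of_tendsto' (hlim s hs) (hlim t ht) fun n => hm n hs ht hst
  intro K _ _ _ a b ha hab
  have hb := ha.trans hab
  have hint : ∀ (c : K →L[ℂ] K), 0 ≤ c → ∀ x, Tendsto (fun n => ∫ t, f n t ∂(spectralMeasure c x))
      atTop (𝓝 (∫ t, g t ∂(spectralMeasure c x))) := fun c hc x => by
    refine tendsto_integral_of_dominated_convergence (fun t => |f 0 t| + |g t|)
      (fun n => (integrable_of_monotoneOn (hm n) hc x).aestronglyMeasurable)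
      ((integrable_of_monotoneOn (hm 0) hc x).abs.add (integrable_of_monotoneOn hg hc x).abs)
      (fun n => ?_) ?_
    · filter_upwards [ae_nonneg_spectralMeasure c hc x] with t ht
      exact (abs_le_max_abs_abs (hincr t ht n.zero_le)
        ((hincr t ht).ge_of_tendsto (hlim t ht) n)).trans
        (max_le_add_of_nonneg (abs_nonneg _) (abs_nonneg _))
    · filter_upwards [ae_nonneg_spectralMeasure c hc x] with t ht using hlim t ht
  exact (borelCalculus_le_iff hg hg ha hb).2 fun x =>
    le_of_tendsto_of_tendsto' (hint a ha x) (hint b hb x) fun n =>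
      (borelCalculus_le_iff (hm n) (hm n) ha hb).1 (hf n K a b ha hab) x

/-- For `f` increasing in its index, `f_r ≤ f_s` for `r ≤ s` in `{0, 1, …, ∞}`. -/
theorem recTopCoe_le {f : ℝ → ℝ → ℝ} {fInf : ℝ → ℝ}
    (hincr : ∀ α β : ℝ, 0 ≤ α → α ≤ β → ∀ t : ℝ, 0 ≤ t → f α t ≤ f β t)
    (hlim : ∀ t : ℝ, 0 ≤ t → Tendsto (fun α : ℝ => f α t) atTop (𝓝 (fInf t)))
    {r s : ℕ∞} (hrs : r ≤ s) {t : ℝ} (ht : 0 ≤ t) :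
    (ENat.recTopCoe fInf (fun n : ℕ => f n) r : ℝ → ℝ) t ≤
      (ENat.recTopCoe fInf (fun n : ℕ => f n) s : ℝ → ℝ) t := by
  induction s using ENat.recTopCoe with
  | top =>
    induction r using ENat.recTopCoe with
    | top => exact le_rfl
    | coe n =>
      refine ge_of_tendsto (hlim t ht) ?_
      filter_upwards [eventually_ge_atTop (n : ℝ)] with α hα using hincr n α n.cast_nonneg hα t ht
  | coe m =>
    induction r using ENat.recTopCoe with
    | top => exact absurd hrs (by simp)
    | coe n => exact hincr n m n.cast_nonneg (by exact_mod_cast hrs) t ht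

end

/-! ### Eigenvectors of multiples of projections -/

section

variable {H : Type*} [NormedAddCommGroup H] [InnerProductSpace ℂ H] [CompleteSpace H]

/-- The operator is `τ` times a projection of rank `n`. -/
theorem exists_nonneg_operatorRank_eq (hH : ¬ FiniteDimensional ℂ H) (n : ℕ) {τ : ℝ} (hτ : 0 < τ) :
    ∃ a : H →L[ℂ] H, 0 ≤ a ∧ operatorRank a = n ∧ (1 ≤ n → ∃ x, x ≠ 0 ∧ a x = τ • x) ∧
      ∃ x, x ≠ 0 ∧ a x = 0 := by
  have hrank : (n : Cardinal) ≤ Module.rank ℂ H :=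
    (Cardinal.natCast_lt_aleph0 (n := n)).le.trans
      (not_lt.1 fun h => hH (Module.rank_lt_aleph0_iff.1 h))
  obtain ⟨s, hs, hli⟩ := exists_finset_linearIndependent_of_le_rank hrank
  obtain ⟨W, hW⟩ : ∃ W : Submodule ℂ H, W = Submodule.span ℂ (s : Set H) := ⟨_, rfl⟩
  have hfin : FiniteDimensional ℂ W := by rw [hW]; infer_instance
  have hWr : Module.finrank ℂ W = n := by
    rw [hW, finrank_span_finset_eq_card hli, hs]
  have hrange : LinearMap.range ((τ • W.starProjection : H →L[ℂ] H) : H →ₗ[ℂ] H) = W := by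
    refine le_antisymm ?_ fun x hx => ⟨τ⁻¹ • x, ?_⟩
    · rintro _ ⟨x, rfl⟩
      exact W.smul_of_tower_mem τ (W.starProjection_apply_mem x)
    · have hx' : τ⁻¹ • x ∈ W := W.smul_of_tower_mem τ⁻¹ hx
      change τ • W.starProjection (τ⁻¹ • x) = x
      rw [Submodule.starProjection_eq_self_iff.2 hx', smul_inv_smul₀ hτ.ne']
  refine ⟨τ • W.starProjection, smul_nonneg hτ.le ?_, ?_, fun hn => ?_, ?_⟩
  · exact isStarProjection_starProjection.nonneg
  · rw [operatorRank, hrange, W.closed_of_finiteDimensional.submodule_topologicalClosure_eq,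
      ← Module.finrank_eq_rank, hWr, map_natCast]
  · have : W ≠ ⊥ := by rintro rfl; simp at hWr; omega
    obtain ⟨x, hx, hx0⟩ := W.exists_mem_ne_zero_of_ne_bot this
    exact ⟨x, hx0, by rw [smul_apply, Submodule.starProjection_eq_self_iff.2 hx]⟩
  · have : Wᗮ ≠ ⊥ := fun h => by
      rw [Submodule.orthogonal_eq_bot_iff] at h
      rw [h] at hfin
      exact hH (Module.finite_def.2 (Module.Finite.iff_fg.1 hfin))
    obtain ⟨x, hx, hx0⟩ := Wᗮ.exists_mem_ne_zero_of_ne_bot this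
    refine ⟨x, hx0, ?_⟩
    rw [smul_apply, (Submodule.starProjection_apply_eq_zero_iff W).2 hx, smul_zero]

theorem apply_eigenvalue_eq_of_borelCalculus_eq_cfc {f g : ℝ → ℝ} (hf : MonotoneOn f (Set.Ici 0))
    (hg : ContinuousOn g (Set.Ici 0)) {a : H →L[ℂ] H} (ha : 0 ≤ a)
    (h : borelCalculus f a = cfc g a) {x : H} (hx : x ≠ 0) {t : ℝ} (hxt : a x = t • x) :
    f t = g t := by
  have hgs : ContinuousOn g (spectrum ℝ a) :=
    hg.mono fun s hs => spectrum_nonneg_of_nonneg ha hs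
  obtain ⟨C, hC⟩ := (ContinuousFunctionalCalculus.isCompact_spectrum (R := ℝ) a
    ).exists_bound_of_continuousOn hgs
  have h1 := inner_borelCalculus_of_monotoneOn hf ha x
  rw [h, ← borelCalculus_eq_cfc hgs, inner_borelCalculus (C := C) hgs.domRestrict.measurable hC,
    integral_spectralMeasure_eigenvector (.of_nonneg ha) hxt,
    integral_spectralMeasure_eigenvector (.of_nonneg ha) hxt] at h1
  exact (mul_left_cancel₀ (by positivity) (Complex.ofReal_injective h1)).symm

end

/-! ### The rank-dependent calculus -/

theorem mainTheorem8 (H : Type u) [NormedAddCommGroup H] [InnerProductSpace ℂ H]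
    [CompleteSpace H] [TopologicalSpace.SeparableSpace H]
    (f : ℝ → ℝ → ℝ) (fInf : ℝ → ℝ)
    (hpos : ∀ α : ℝ, 0 ≤ α → ∀ t : ℝ, 0 ≤ t → 0 ≤ f α t)
    (hmono : ∀ α : ℝ, 0 ≤ α → OperatorMonotone.{u} (f α))
    (hincr : ∀ α β : ℝ, 0 ≤ α → α ≤ β → ∀ t : ℝ, 0 ≤ t → f α t ≤ f β t)
    (hlim : ∀ t : ℝ, 0 ≤ t → Tendsto (fun α : ℝ => f α t) atTop (𝓝 (fInf t))) :
    (∀ a : H →L[ℂ] H, 0 ≤ a → 0 ≤ rankCalculus f fInf a) ∧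
    (∀ a b : H →L[ℂ] H, 0 ≤ a → a ≤ b → rankCalculus f fInf a ≤ rankCalculus f fInf b) ∧
    (∀ c : H →L[ℂ] H, IsUnit c → ‖c‖ ≤ 1 → ∀ a : H →L[ℂ] H, 0 ≤ a →
      star c * rankCalculus f fInf a * c ≤ rankCalculus f fInf (star c * a * c)) ∧
    (¬ FiniteDimensional ℂ H →
      (∃ m n : ℕ, 1 ≤ m ∧ 1 ≤ n ∧ ∃ t : ℝ, 0 ≤ t ∧ f m t ≠ f n t) →
      ¬ ∃ g : ℝ → ℝ, ContinuousOn g (Set.Ici 0) ∧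
        ∀ a : H →L[ℂ] H, 0 ≤ a → rankCalculus f fInf a = cfc g a) := by
  obtain ⟨F, hF⟩ : ∃ F : ℕ∞ → ℝ → ℝ, F = fun r => ENat.recTopCoe fInf (fun n : ℕ => f n) r :=
    ⟨_, rfl⟩
  have hFn : ∀ n : ℕ, F n = f n := fun n => by rw [hF]; rfl
  have hφ : ∀ a : H →L[ℂ] H, rankCalculus f fInf a = borelCalculus (F (operatorRank a)) a :=
    fun a => by rw [hF]; rfl
  have hFle : ∀ {r s : ℕ∞}, r ≤ s → ∀ {t : ℝ}, 0 ≤ t → F r t ≤ F s t := fun hrs _ ht => by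
    rw [hF]; exact recTopCoe_le hincr hlim hrs ht
  have hFpos : ∀ (r : ℕ∞) (t : ℝ), 0 ≤ t → 0 ≤ F r t := fun r t ht =>
    (hpos 0 le_rfl t ht).trans (by simpa using (hFn 0 ▸ hFle (zero_le (a := r)) ht :))
  have hFmono : ∀ r : ℕ∞, OperatorMonotone.{u} (F r) := by
    intro r
    induction r using ENat.recTopCoe with
    | top =>
      rw [hF]
      exact .of_tendsto (f := fun n => f n) (fun n => hmono n n.cast_nonneg)
        (fun t ht m n hmn => hincr m n m.cast_nonneg (by exact_mod_cast hmn) t ht)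
        fun t ht => (hlim t ht).comp tendsto_natCast_atTop_atTop
    | coe n => rw [hFn]; exact hmono n n.cast_nonneg
  have hFm := fun r => (hFmono r).monotoneOn
  have hindex : ∀ {r s : ℕ∞}, r ≤ s → ∀ {a : H →L[ℂ] H}, 0 ≤ a →
      borelCalculus (F r) a ≤ borelCalculus (F s) a := fun hrs a ha =>
    (borelCalculus_le_iff (hFm _) (hFm _) ha ha).2 fun x =>
      integral_mono_ae (integrable_of_monotoneOn (hFm _) ha x)
        (integrable_of_monotoneOn (hFm _) ha x) (by
          filter_upwards [ae_nonneg_spectralMeasure a ha x] with t ht using hFle hrs ht)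
  refine ⟨fun a ha => ?_, fun a b ha hab => ?_, fun c hc hc1 a ha => ?_, ?_⟩
  · rw [hφ]
    refine nonneg_of_inner_eq_ofReal (inner_borelCalculus_of_monotoneOn (hFm _) ha) fun x =>
      integral_nonneg_of_ae ?_
    filter_upwards [ae_nonneg_spectralMeasure a ha x] with t ht using hFpos _ t ht
  · rw [hφ, hφ]
    exact (hFmono _ H a b ha hab).trans (hindex (operatorRank_mono ha hab) (ha.trans hab))
  · rw [hφ, hφ]
    exact ((hFmono _).conj_borelCalculus_le (hFpos _) hc1 ha).trans
      (hindex (operatorRank_le_conj hc a) (star_left_conjugate_nonneg ha c))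
  · rintro hH ⟨m, n, hm, hn, t, ht, hne⟩ ⟨g, hg, hgφ⟩
    have key : ∀ k : ℕ, 1 ≤ k → f k t = g t := by
      intro k hk
      -- The eigenvector is in the range of a rank `k` projection if `t > 0`, in its kernel if
      -- `t = 0`.
      obtain ⟨a, x, ha, hrank, hx, hxt⟩ : ∃ (a : H →L[ℂ] H) (x : H), 0 ≤ a ∧
          operatorRank a = k ∧ x ≠ 0 ∧ a x = t • x := by
        rcases ht.eq_or_lt with rfl | ht'
        · obtain ⟨a, ha, hrank, -, x, hx, hx0⟩ := exists_nonneg_operatorRank_eq hH k one_pos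
          exact ⟨a, x, ha, hrank, hx, by rw [hx0, zero_smul]⟩
        · obtain ⟨a, ha, hrank, hx, -⟩ := exists_nonneg_operatorRank_eq hH k ht'
          obtain ⟨x, hx, hxt⟩ := hx hk
          exact ⟨a, x, ha, hrank, hx, hxt⟩
      have h := hgφ a ha
      rw [hφ, hrank, hFn] at h
      exact apply_eigenvalue_eq_of_borelCalculus_eq_cfc (hFn k ▸ hFm k) hg ha h hx hxt
    exact hne ((key m hm).trans (key n hn).symm)
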